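/- Notation. Let $\mathcal M\subset\mathbb R^n$ be a compact boundaryless $C^2$-submanifold of dimension $d$ (compact, and for some $r_1>r_2>0$ and every $z\in\mathcal M$ there is a $d$-dimensional linear subspace $T_z\mathcal M$ such that, inside the open ball $B(z,r_2)$, $\mathcal M$ coincides with the graph $\{z+x+\Psi(x): x\in T_z\mathcal M,\ \|x\|<r_1\}$ of a $C^2$ function $\Psi$ with values in $(T_z\mathcal M)^\perp$, $\Psi(0)=0$, $D\Psi(0)=0$). Assume that $\mathcal M$ lies in the closed unit ball, has finite $d$-dimensional volume $V=\mathrm{Vol}_d(\mathcal M)\le V_{\max}$, and has reach at least $\tau>0$ (for instance $\tau$ is the reach); the reach is the largest $r$ such that every point at distance less than $r$ from $\mathcal M$ has a unique closest point on $\mathcal M$. For $\bar\tau>0$, the cylinder with center $x$ and $d$-dimensional direction $T$ is $$\{y:\ \|\Pi_T(y-x)\|\le\bar\tau,\ \|(y-x)-\Pi_T(y-x)\|\le\bar\tau\},$$ where $\Pi_T$ is the orthogonal projection onto the linear subspace $T$; its central cross-section is $\{y: y-x\in T,\ \|y-x\|\le\bar\tau\}$. Lemma. For every $d$ there are constants $c>0$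 and $K>0$ depending only on $d$ such that the following holds for every $n$, every $\mathcal M\subset\mathbb R^n$, $V_{\max}$ and $\tau$ as above, and every $0<\bar\tau\le c\,\tau$. Let $x_1,\dots,x_m\in\mathcal M$ form a $\bar\tau/2$-net of $\mathcal M$ (every $p\in\mathcal M$ satisfies $\|p-x_i\|<\bar\tau/2$ for some $i$) with $\|x_i-x_j\|\ge\bar\tau/2.9$ for $i\ne j$, and let $\mathrm{cyl}_i$ be the cylinder with center $x_i$ and direction the tangent space $T_{x_i}\mathcal M$. Then the collection $\{\mathrm{cyl}_i\}$ is a cylinder packet, that is: 1. $m\le K\,V/\bar\tau^{\,d}$. 2. For every $i$, let $S_i$ be the set of all $j\ne i$ for which $\mathrm{cyl}_j$ intersects $\mathrm{cyl}_i$. For each $j\in S_i$ there are a proper rotation $U_j$ of $\mathbb R^n$ fixing $x_j$ and a translation $Tr_j$ by a vector $t_j$ such that (a) for all $j\in S_i$, $Tr_jU_j\,\mathrm{cyl}_j$ is the translate of $\mathrm{cyl}_i$, and $Tr_jU_j$ maps the central cross-section of $\mathrm{cyl}_j$ onto the corresponding translate of that of $\mathrm{cyl}_i$, by a vector in $T_{x_i}\mathcal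 M$ of norm at least $\bar\tau/3$; (b) every point $p$ of the central cross-section of $\mathrm{cyl}_i$ is at distance less than $\bar\tau/2$ from some point of $\{x_i\}\cup\{Tr_jU_jx_j: j\in S_i\}$, and if $\|p-x_i\|\le\bar\tau/2$ from such a point that lies in $\mathrm{cyl}_i$; (c) $\|v-U_jv\|<2K\frac{\bar\tau}{\tau}\|v-x_j\|$ for all $j\in S_i$ and all $v\in\mathbb R^n$ with $v\ne x_j$; (d) $\|t_j\|<K\frac{\bar\tau^2}{\tau}$ for all $j\in S_i$. -/

import Mathlib

open MeasureTheory Metric Set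
open scoped ENNReal NNReal

namespace CylPacket

/-- `ℝⁿ` with the Euclidean norm. -/
abbrev E (n : ℕ) : Type := EuclideanSpace ℝ (Fin n)

/-! ### Compact imbedded manifolds, tangent spaces, reach -/

/-- Inside the open ball `B(z, r₂)` the set `M` coincides with a `C²` patch of radius `r₁ > r₂ > 0`
over the linear subspace `T`, centred at `z` and tangent to `T` at `z`: the graph
`{z + x + Ψ x | x ∈ T, ‖x‖ < r₁}` of a `C²` function `Ψ` from the ball of radius `r₁` of `T` to `Tᗮ`
with `Ψ 0 = 0` and vanishing derivative at `0`. -/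
def IsPatchAt {n : ℕ} (M : Set (E n)) (r₁ r₂ : ℝ) (z : E n) (T : Submodule ℝ (E n)) : Prop :=
  0 < r₂ ∧ r₂ < r₁ ∧ ∃ Ψ : T → Tᗮ,
    ContDiffOn ℝ 2 Ψ (ball 0 r₁) ∧ Ψ 0 = 0 ∧ fderiv ℝ Ψ 0 = 0 ∧
    M ∩ ball z r₂ = {y | ∃ x ∈ ball (0 : T) r₁, y = z + (x : E n) + (Ψ x : E n)} ∩ ball z r₂

/-- `T` is the (linear) tangent space of the `d`-dimensional manifold `M` at its point `z`. -/
def IsTangentSpaceAt {n : ℕ} (M : Set (E n)) (d : ℕ) (z : E n) (T : Submodule ℝ (E n)) : Prop :=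
  z ∈ M ∧ Module.finrank ℝ T = d ∧ ∃ r₁ r₂ : ℝ, IsPatchAt M r₁ r₂ z T

/-- `M` is a compact imbedded `d`-manifold of class `C²` (without boundary) in `ℝⁿ`. The radii of
the patches are uniform over `M`. -/
def IsCompactImbedded {n : ℕ} (M : Set (E n)) (d : ℕ) : Prop :=
  IsCompact M ∧ ∃ r₁ r₂ : ℝ, 0 < r₂ ∧ r₂ < r₁ ∧
    ∀ z ∈ M, ∃ T : Submodule ℝ (E n), Module.finrank ℝ T = d ∧ IsPatchAt M r₁ r₂ z T

/-- The reach of `M`: the largest `r` such that every point at distance less than `r` from `M` has a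
unique closest point in `M`. -/
noncomputable def reach {n : ℕ} (M : Set (E n)) : ℝ≥0∞ :=
  ⨆ (r : ℝ≥0) (_ : ∀ x : E n, infEDist x M < r → ∃! y, y ∈ M ∧ edist x y = infEDist x M),
    (r : ℝ≥0∞)

/-- The `d`-dimensional volume of `M` (Hausdorff measure, normalised to agree with Lebesgue measure
on `ℝᵈ`). -/
noncomputable def vol {n : ℕ} (d : ℕ) (M : Set (E n)) : ℝ≥0∞ :=
  Measure.euclideanHausdorffMeasure d M

/-- The family `𝒢(d, V, τ)` of boundaryless `C²` submanifolds of the unit ball of `ℝⁿ` with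
dimension `d`, volume at most `V` and reach at least `τ`. -/
structure InClass {n : ℕ} (d : ℕ) (V : ℝ≥0) (τ : ℝ) (M : Set (E n)) : Prop where
  imbedded : IsCompactImbedded M d
  subset_unitBall : M ⊆ closedBall 0 1
  vol_le : vol d M ≤ V
  le_reach : ENNReal.ofReal τ ≤ reach M

/-- `Y ⊆ M` is an `η`-net of `M`. -/
def IsNet {n : ℕ} (η : ℝ) (Y M : Set (E n)) : Prop :=
  Y ⊆ M ∧ ∀ p ∈ M, ∃ y ∈ Y, ‖p - y‖ < η

/-! ### Cylinders and cylinder packets -/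

/-- The data of a cylinder isometric to `τbar (B_d × B_{n-d})`: its centre and the direction of its
`d`-dimensional central cross-section. -/
structure Cylinder (n d : ℕ) where
  center : E n
  dir : Submodule ℝ (E n)
  finrank_dir : Module.finrank ℝ dir = d

/-- The cylinder as a point set. -/
def Cylinder.carrier {n d : ℕ} (C : Cylinder n d) (τbar : ℝ) : Set (E n) :=
  {y | ‖C.dir.starProjection (y - C.center)‖ ≤ τbar ∧
    ‖(y - C.center) - C.dir.starProjection (y - C.center)‖ ≤ τbar}

/-- The `d`-dimensional central cross-section of the cylinder. -/
def Cylinder.cross {n d : ℕ} (C : Cylinder n d) (τbar : ℝ) : Set (E n) :=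
  {y | y - C.center ∈ C.dir ∧ ‖y - C.center‖ ≤ τbar}

/-- The indices of the other cylinders that intersect the `i`-th one. -/
def neighbors {n d m : ℕ} (C : Fin m → Cylinder n d) (τbar : ℝ) (i : Fin m) : Set (Fin m) :=
  {j | j ≠ i ∧ ((C j).carrier τbar ∩ (C i).carrier τbar).Nonempty}

/-- The rotation `v ↦ p + R (v - p)` about the point `p` with linear part `R`. -/
noncomputable def rotAbout {n : ℕ} (p : E n) (R : E n ≃ₗᵢ[ℝ] E n) (v : E n) : E n := p + R (v - p)

/-- A collection of `m` cylinders of size `τbar` is a cylinder packet for the volume `V`, the reach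
parameter `τ` and the constant factor `K`. Here `R j` is the linear part of the proper rotation
`U_j` about the centre of the `j`-th cylinder, and `t j` is the vector of the translation `Tr_j`. -/
def IsCylinderPacket {n d m : ℕ} (K : ℝ) (V : ℝ≥0∞) (τ τbar : ℝ)
    (C : Fin m → Cylinder n d) : Prop :=
  (m : ℝ≥0∞) ≤ ENNReal.ofReal (K / τbar ^ d) * V ∧
  ∀ i : Fin m, ∃ (R : Fin m → (E n ≃ₗᵢ[ℝ] E n)) (t : Fin m → E n),
    -- the rotations are proper
    (∀ j ∈ neighbors C τbar i,
      LinearMap.det ((R j).toLinearEquiv : E n →ₗ[ℝ] E n) = 1) ∧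
    -- each moved cylinder, with its central cross-section, is a translate of the `i`-th cylinder
    -- by a vector of its cross-section's direction, of norm at least `τbar / 3`
    (∀ j ∈ neighbors C τbar i, ∃ w ∈ (C i).dir, τbar / 3 ≤ ‖w‖ ∧
      (fun v => rotAbout (C j).center (R j) v + t j) '' (C j).carrier τbar =
        (fun v => v + w) '' (C i).carrier τbar ∧
      (fun v => rotAbout (C j).center (R j) v + t j) '' (C j).cross τbar =
        (fun v => v + w) '' (C i).cross τbar) ∧
    -- every point of the `i`-th central cross-section is closer than `τbar / 2` to the centre of the
    -- `i`-th cylinder or to a moved centre, and to one lying in the `i`-th cylinder unless the point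
    -- is farther than `τbar / 2` from the centre
    (∀ p ∈ (C i).cross τbar, ∃ y ∈ ({(C i).center} : Set (E n)) ∪
        (fun j => rotAbout (C j).center (R j) (C j).center + t j) '' neighbors C τbar i,
      ‖p - y‖ < τbar / 2 ∧ (‖p - (C i).center‖ ≤ τbar / 2 → y ∈ (C i).carrier τbar)) ∧
    -- the rotations are small
    (∀ j ∈ neighbors C τbar i, ∀ v : E n, v ≠ (C j).center →
      ‖v - rotAbout (C j).center (R j) v‖ < K * (2 * (τbar / τ)) * ‖v - (C j).center‖) ∧
    -- the translations are small
    (∀ j ∈ neighbors C τbar i, ‖t j‖ < K * (τbar ^ 2 / τ))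

end CylPacket

/-!
The whole lemma rests on two facts about tangent spaces `T` of `M` at its points `z`
(`HasTangent`): every vector of `T` is the velocity of a curve in `M`, and `M` does not meet the
open balls of radius `τ` that touch it at `z` in the directions normal to `T`, that is,
`⟪u, q - z⟫ ≤ ‖u‖ ‖q - z‖² / (2 τ)` for normal `u` and `q ∈ M`.

The first fact, and the second for a small radius, come from the `C²` patch at `z`. The radius
extends to `τ` because nearest points are unique at distance less than `τ`: there the distance
function has slope one in some direction at each point off `M`, so on a ball of radius `ε` about
`z + r u` it reaches the value `r + ε`. This forces equality in the triangle inequality, so the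
maximum is attained at `z + (r + ε) u`, and `z` is still a nearest point (`inner_le_of_nearest`).

All further geometry is obtained by looking at maxima and minima over compact pieces of `M`.
* A unit vector normal to `M` at `x` has tangential part at most `4 ℓ / τ` at points `q ∈ M` with
  `‖q - x‖ ≤ ℓ`; otherwise `M` could be followed from `q` so as to gain too much height over the
  tangent space at `x` (`norm_starProjection_normal_le`). So tangent spaces at nearby points make
  a small angle.
* Near `x` the projection of `M` to the tangent space at `x` is onto
  (`HasTangent.exists_starProjection_eq`).

The projection being onto and not increasing volume, `M` has at least a multiple of `τbar ^ d` of
volume near each `x_i`, which bounds `m` (`card_le_mul_vol`). Subspaces of dimension `d` at a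
small angle are carried one to the other by a proper rotation near the identity, a product of `d`
rotations in planes (`exists_rotation_map_eq`); these give the rotations of the cylinders. The
translations cancel the normal parts of `x_j - x_i`. A point `p` of the `i`-th cross-section lies
below some `q ∈ M`; a net point `x_j` within `τbar / 2` of `q` projects to within `τbar / 2` of
`p`, and its projection is the moved centre.
-/

namespace CylPacket

open scoped InnerProductSpace

/-! ### Distance to a set with unique nearest points -/

section Reach

variable {F : Type*} [NormedAddCommGroup F] [InnerProductSpace ℝ F]

/-- If `z` has a unique nearest point `p` in `M`, then moving `z` away from `p` increases the
distance to `M` at unit rate, to first order. -/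
theorem infDist_add_smul_ge {M : Set F} (hM : IsCompact M) {z p : F} (hp : p ∈ M)
    (hz : ‖z - p‖ = infDist z M) (huniq : ∀ q ∈ M, ‖z - q‖ = infDist z M → q = p)
    (hpos : 0 < infDist z M) {η : ℝ} (hη : 0 < η) (hη1 : η ≤ 1) :
    ∃ h₀ > 0, ∀ h, 0 < h → h ≤ h₀ →
      infDist z M + (1 - η) * h ≤ infDist (z + h • (‖z - p‖⁻¹ • (z - p))) M := by
  set δ := infDist z M with hδ
  set n := ‖z - p‖⁻¹ • (z - p) with hn
  have hn1 : ‖n‖ = 1 := by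
    rw [hn, norm_smul, norm_inv, norm_norm, inv_mul_cancel₀]; rw [hz]; exact hpos.ne'
  have hnp : ⟪n, z - p⟫_ℝ = δ := by
    rw [hn, real_inner_smul_left, real_inner_self_eq_norm_sq, hz]; field_simp
  have hle : ∀ q ∈ M, δ ≤ ‖z - q‖ := fun q hq => by
    rw [← dist_eq_norm]; exact infDist_le_dist_of_mem hq
  -- the points of `M` in whose direction the distance grows too slowly form a compact set,
  -- which stays away from the sphere of radius `δ`
  set S := M ∩ {q | ⟪n, z - q⟫_ℝ ≤ (1 - η) * δ} with hS
  have hSc : IsCompact S := hM.inter_right (isClosed_le (by fun_prop) (by fun_prop))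
  obtain ⟨κ, hκ, hκS⟩ : ∃ κ > 0, ∀ q ∈ S, δ + κ ≤ ‖z - q‖ := by
    rcases S.eq_empty_or_nonempty with h | h
    · exact ⟨1, one_pos, by simp [h]⟩
    · obtain ⟨q, hq, hmin⟩ := hSc.exists_isMinOn h
        (f := fun q => ‖z - q‖) (by fun_prop)
      have : δ < ‖z - q‖ := by
        refine lt_of_le_of_ne (hle q hq.1) fun he => ?_
        have h2 := hq.2
        rw [huniq q hq.1 he.symm, mem_ofPred_eq, hnp] at h2
        nlinarith
      exact ⟨‖z - q‖ - δ, by linarith, fun q' hq' => by have := hmin hq'; simp at this; linarith⟩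
  refine ⟨κ / 2, by linarith, fun h h0 hh => ?_⟩
  rw [le_infDist ⟨p, hp⟩]
  intro q hq
  rw [dist_eq_norm]
  by_cases hqS : q ∈ S
  · have h1 := hκS q hqS
    have h2 : ‖z - q‖ ≤ ‖z + h • n - q‖ + ‖h • n‖ := by
      have := norm_sub_le (z + h • n - q) (h • n)
      rwa [show z + h • n - q - h • n = z - q by abel] at this
    rw [norm_smul, hn1, mul_one, Real.norm_of_nonneg h0.le] at h2
    nlinarith
  · have h1 : (1 - η) * δ < ⟪n, z - q⟫_ℝ := by
      by_contra hc
      exact hqS ⟨hq, not_lt.mp hc⟩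
    refine le_of_sq_le_sq ?_ (norm_nonneg _)
    have h2 : ‖z + h • n - q‖ ^ 2 = ‖z - q‖ ^ 2 + 2 * h * ⟪n, z - q⟫_ℝ + h ^ 2 := by
      rw [show z + h • n - q = (z - q) + h • n by abel, norm_add_sq_real, norm_smul, hn1,
        real_inner_smul_right, real_inner_comm, Real.norm_of_nonneg h0.le]
      ring
    rw [h2]
    have h3 := hle q hq
    have h4 : δ ^ 2 ≤ ‖z - q‖ ^ 2 := by gcongr
    have h5 : (1 - η) ^ 2 * h ^ 2 ≤ h ^ 2 := by
      have : (1 - η) ^ 2 ≤ 1 := by nlinarith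
      nlinarith [sq_nonneg h]
    have h6 := mul_le_mul_of_nonneg_left h1.le (by linarith : (0:ℝ) ≤ 2 * h)
    nlinarith

/-- Where nearest points are unique, the distance to `M` can be increased by `ε` within the ball
of radius `ε`: a maximum of `infDist z M - (1 - η) * dist z y` on that ball lies on its boundary,
since at an interior point the distance to `M` grows at unit rate in some direction. -/
theorem exists_infDist_ge_add [ProperSpace F] {M : Set F} (hM : IsCompact M) {τ : ℝ}
    (hU : ∀ x, infDist x M < τ → ∃! y, y ∈ M ∧ dist x y = infDist x M)
    {y : F} (hy : 0 < infDist y M) {ε : ℝ} (hε : 0 < ε)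
    (hετ : infDist y M + ε < τ) :
    ∃ z, dist z y ≤ ε ∧ infDist y M + ε ≤ infDist z M := by
  have hcb : IsCompact (closedBall y ε) := isCompact_closedBall y ε
  have hcne : (closedBall y ε).Nonempty := ⟨y, mem_closedBall_self hε.le⟩
  have key : ∀ η : ℝ, 0 < η → η ≤ 1 →
      ∃ z ∈ closedBall y ε, infDist y M + (1 - η) * ε ≤ infDist z M := by
    intro η hη hη1
    -- the factor `1 - η` leaves room for the first-order error of the growth of the distance
    obtain ⟨z, hz, hmax⟩ := hcb.exists_isMaxOn hcne
      (f := fun z => infDist z M - (1 - η) * dist z y)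
      ((continuous_infDist_pt M).sub (by fun_prop)).continuousOn
    refine ⟨z, hz, ?_⟩
    have hge : infDist y M ≤ infDist z M - (1 - η) * dist z y := by
      have := hmax (mem_closedBall_self hε.le); simpa using this
    rcases (mem_closedBall.mp hz).lt_or_eq with hlt | heq
    · exfalso
      have hd0 : 0 ≤ (1 - η) * dist z y := mul_nonneg (by linarith) dist_nonneg
      have hzpos : 0 < infDist z M := by linarith
      have hzτ : infDist z M < τ := by
        have := infDist_le_infDist_add_dist (s := M) (x := z) (y := y)
        linarith
      obtain ⟨p, ⟨hpM, hp⟩, hpu⟩ := hU z hzτ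
      obtain ⟨h₀, hh₀, hgrow⟩ := infDist_add_smul_ge hM hpM (by rw [← dist_eq_norm, hp])
        (fun q hq hqe => hpu q ⟨hq, by rw [dist_eq_norm, hqe]⟩) hzpos
        (half_pos hη) (by linarith)
      set h := min h₀ (ε - dist z y) with hh
      have hhpos : 0 < h := lt_min hh₀ (by linarith)
      have h1 := hgrow h hhpos (min_le_left _ _)
      set n := ‖z - p‖⁻¹ • (z - p) with hn
      have hn1 : ‖n‖ = 1 := by
        rw [hn, norm_smul, norm_inv, norm_norm, inv_mul_cancel₀]
        rw [← dist_eq_norm, hp]; exact hzpos.ne'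
      have h2 : dist (z + h • n) y ≤ dist z y + h := by
        have := dist_triangle (z + h • n) z y
        rw [dist_self_add_left, norm_smul, hn1, mul_one, Real.norm_of_nonneg hhpos.le] at this
        linarith
      have h3 := hmax (a := z + h • n) (by
        rw [mem_closedBall]; have := min_le_right h₀ (ε - dist z y); linarith)
      simp only [mem_ofPred_eq] at h3
      nlinarith [mul_le_mul_of_nonneg_left h2 (by linarith : 0 ≤ 1 - η)]
    · rw [heq] at hge; linarith
  obtain ⟨z, hz, hmax⟩ := hcb.exists_isMaxOn hcne (continuous_infDist_pt M).continuousOn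
  refine ⟨z, mem_closedBall.mp hz, ?_⟩
  by_contra hc
  push Not at hc
  set g := infDist y M + ε - infDist z M with hg
  have hg0 : 0 < g := by linarith
  set η := min 1 (g / (2 * ε)) with hη
  have hη0 : 0 < η := lt_min one_pos (by positivity)
  obtain ⟨z', hz', h1⟩ := key η hη0 (min_le_left _ _)
  have h2 : infDist z' M ≤ infDist z M := hmax hz'
  have h3 : η * ε ≤ g / 2 := by
    have := mul_le_mul_of_nonneg_right (min_le_right 1 (g / (2 * ε))) hε.le
    rw [show g / (2 * ε) * ε = g / 2 by field_simp] at this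
    exact this
  linarith

/-- If `x ∈ M` is a nearest point of `x + r • u` for one `r < τ`, then it is one of `x + s • u`
for every `s < τ`, so `M` does not meet the open ball of radius `τ` that touches it at `x` in the
direction `u`. -/
theorem inner_le_of_nearest [ProperSpace F] {M : Set F} (hM : IsCompact M) {τ : ℝ}
    (hU : ∀ x, infDist x M < τ → ∃! y, y ∈ M ∧ dist x y = infDist x M)
    {x u : F} (hx : x ∈ M) (hu : ‖u‖ = 1) {r : ℝ} (hr : 0 < r) (hrτ : r < τ)
    (hnear : infDist (x + r • u) M = r) {q : F} (hq : q ∈ M) :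
    ⟪u, q - x⟫_ℝ ≤ ‖q - x‖ ^ 2 / (2 * τ) := by
  have key : ∀ s, r < s → s < τ → 2 * s * ⟪u, q - x⟫_ℝ ≤ ‖q - x‖ ^ 2 := by
    intro s hrs hsτ
    obtain ⟨z, hz1, hz2⟩ := exists_infDist_ge_add hM hU (y := x + r • u)
      (by rw [hnear]; exact hr) (sub_pos.mpr hrs) (by rw [hnear]; linarith)
    rw [hnear] at hz2
    have hzx : s ≤ dist z x := by
      have := infDist_le_dist_of_mem (x := z) hx
      linarith
    -- equality in the triangle inequality puts `z` on the ray from `x` in the direction `u`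
    have hze : z = x + s • u := by
      set v := z - (x + r • u) with hv
      have hv1 : ‖v‖ ≤ s - r := by rw [hv, ← dist_eq_norm]; exact hz1
      have hzv : z - x = v + r • u := by rw [hv]; abel
      have h2 : s ≤ ‖v + r • u‖ := by rw [← hzv, ← dist_eq_norm]; exact hzx
      have h3 : ‖v + r • u‖ ^ 2 = ‖v‖ ^ 2 + 2 * r * ⟪v, u⟫_ℝ + r ^ 2 := by
        rw [norm_add_sq_real, norm_smul, hu, real_inner_smul_right, Real.norm_of_nonneg hr.le]; ring
      have h4 : ‖v - (s - r) • u‖ ^ 2 = ‖v‖ ^ 2 - 2 * (s - r) * ⟪v, u⟫_ℝ + (s - r) ^ 2 := by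
        rw [norm_sub_sq_real, norm_smul, hu, real_inner_smul_right,
          Real.norm_of_nonneg (by linarith)]; ring
      have h5 : s ^ 2 ≤ ‖v + r • u‖ ^ 2 := by
        have : 0 ≤ s := by linarith
        gcongr
      have h6 : ‖v‖ ^ 2 ≤ (s - r) ^ 2 := by gcongr
      have h7 : (s - r) * r ≤ r * ⟪v, u⟫_ℝ := by nlinarith
      have h8 : s - r ≤ ⟪v, u⟫_ℝ := by
        by_contra hc; push Not at hc; nlinarith
      have h9 : ‖v - (s - r) • u‖ ^ 2 ≤ 0 := by
        rw [h4]; nlinarith [mul_le_mul_of_nonneg_left h8 (by linarith : 0 ≤ s - r)]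
      have h10 : v - (s - r) • u = 0 := by
        rw [← norm_eq_zero]; exact pow_eq_zero_iff two_ne_zero |>.mp (le_antisymm h9 (sq_nonneg _))
      have h11 : v = (s - r) • u := sub_eq_zero.mp h10
      rw [← sub_eq_iff_eq_add', hzv, h11, ← add_smul]; congr 1; ring
    have h1 : s ≤ dist z q := by
      have := infDist_le_dist_of_mem (x := z) hq
      linarith
    rw [hze, dist_eq_norm, show x + s • u - q = s • u - (q - x) by abel] at h1
    have h2 : s ^ 2 ≤ ‖s • u - (q - x)‖ ^ 2 := by
      have : 0 ≤ s := by linarith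
      gcongr
    rw [norm_sub_sq_real, norm_smul, hu, real_inner_smul_left,
      Real.norm_of_nonneg (by linarith)] at h2
    linarith
  have hτ : 0 < τ := hr.trans hrτ
  rw [le_div_iff₀ (by linarith)]
  by_contra hc
  push Not at hc
  have hlim : Filter.Tendsto (fun s : ℝ => 2 * s * ⟪u, q - x⟫_ℝ) (nhdsWithin τ (Iio τ))
      (nhds (2 * τ * ⟪u, q - x⟫_ℝ)) :=
    (Continuous.tendsto (by fun_prop) τ).mono_left nhdsWithin_le_nhds
  have := le_of_tendsto hlim (by
    filter_upwards [Ioo_mem_nhdsLT hrτ] with s hs using key s hs.1 hs.2)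
  linarith

end Reach

/-! ### Tangent spaces of patches -/

/-- The definition of the reach in terms of real-valued distances. -/
theorem existsUnique_nearest_of_le_reach {n : ℕ} {M : Set (E n)} (hne : M.Nonempty) {τ : ℝ}
    (hτ : ENNReal.ofReal τ ≤ reach M) (x : E n) (hx : infDist x M < τ) :
    ∃! y, y ∈ M ∧ dist x y = infDist x M := by
  have hfin : infEDist x M ≠ ⊤ := infEDist_ne_top hne
  have h1 : infEDist x M < reach M := by
    refine lt_of_lt_of_le ?_ hτ
    rw [← ENNReal.ofReal_toReal hfin]
    exact (ENNReal.ofReal_lt_ofReal_iff (lt_of_le_of_lt infDist_nonneg hx)).mpr hx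
  obtain ⟨r, hr⟩ := lt_iSup_iff.mp h1
  obtain ⟨hr1, hr2⟩ := lt_iSup_iff.mp hr
  have := hr1 x hr2
  refine (existsUnique_congr fun y => ?_).mp this
  refine and_congr_right fun _ => ?_
  rw [edist_dist, infDist, ← ENNReal.toReal_eq_toReal_iff' ENNReal.ofReal_ne_top hfin,
    ENNReal.toReal_ofReal dist_nonneg]

/-- A `C²` map that vanishes to first order at `0` is `O(‖a‖²)` there. -/
theorem exists_norm_le_mul_sq {A B : Type*} [NormedAddCommGroup A] [NormedSpace ℝ A]
    [NormedAddCommGroup B] [NormedSpace ℝ B] {Ψ : A → B} (hΨ : ContDiffAt ℝ 2 Ψ 0) (h0 : Ψ 0 = 0)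
    (h1 : fderiv ℝ Ψ 0 = 0) :
    ∃ C ρ : ℝ, 0 ≤ C ∧ 0 < ρ ∧ ∀ a, ‖a‖ < ρ → ‖Ψ a‖ ≤ C * ‖a‖ ^ 2 := by
  have hd : ContDiffAt ℝ 1 (fderiv ℝ Ψ) 0 := hΨ.fderiv_right (by norm_num)
  obtain ⟨K, t, ht, hK⟩ := hd.exists_lipschitzOnWith
  have hdiff : ∀ᶠ a in nhds (0 : A), DifferentiableAt ℝ Ψ a :=
    (hΨ.eventually (by simp)).mono fun a ha => ha.differentiableAt (by simp)
  obtain ⟨ρ, hρ, hsub⟩ := Metric.mem_nhds_iff.mp (Filter.inter_mem ht hdiff)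
  refine ⟨K, ρ, K.2, hρ, fun a ha => ?_⟩
  have hball : ∀ b ∈ closedBall (0 : A) ‖a‖, b ∈ t ∧ DifferentiableAt ℝ Ψ b := fun b hb =>
    hsub (mem_ball_zero_iff.mpr (lt_of_le_of_lt (mem_closedBall_zero_iff.mp hb) ha))
  have := (convex_closedBall (0 : A) ‖a‖).norm_image_sub_le_of_norm_fderiv_le (𝕜 := ℝ)
    (f := Ψ) (C := K * ‖a‖) (x := 0) (y := a) (fun b hb => (hball b hb).2) (fun b hb => by
      have h2 := hK.norm_sub_le (hball b hb).1 (mem_of_mem_nhds ht)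
      rw [h1, sub_zero, sub_zero] at h2
      exact h2.trans (by gcongr; exact mem_closedBall_zero_iff.mp hb))
    (by simp) (by simp)
  rw [h0, sub_zero, sub_zero] at this
  linarith

/-- The two properties of a tangent space `T` of `M` at `z` that the argument uses: `M` stays
outside the open balls of radius `τ` that touch it at `z` in a direction normal to `T`, and every
vector of `T` is the velocity of a curve in `M`. -/
structure HasTangent {F : Type*} [NormedAddCommGroup F] [InnerProductSpace ℝ F]
    (M : Set F) (τ : ℝ) (z : F) (T : Submodule ℝ F) : Prop where
  mem : z ∈ M
  inner_le : ∀ u ∈ Tᗮ, ∀ q ∈ M, ⟪u, q - z⟫_ℝ ≤ ‖u‖ * (‖q - z‖ ^ 2 / (2 * τ))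
  exists_curve : ∀ v ∈ T, ∃ γ : ℝ → F, γ 0 = z ∧ HasDerivAt γ v 0 ∧ ∀ᶠ s in nhds 0, γ s ∈ M

/-- A patch stays quadratically close to its tangent plane near its centre, with a constant that
depends on the patch; `IsPatchAt.hasTangent` replaces it by `1 / (2 * τ)` on all of `M`. -/
theorem IsPatchAt.exists_inner_le {n : ℕ} {M : Set (E n)} {r₁ r₂ : ℝ} {z : E n}
    {T : Submodule ℝ (E n)} (h : IsPatchAt M r₁ r₂ z T) :
    ∃ C ρ : ℝ, 0 ≤ C ∧ 0 < ρ ∧ ∀ q ∈ M, ‖q - z‖ < ρ → ∀ u ∈ Tᗮ,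
      ⟪u, q - z⟫_ℝ ≤ C * ‖u‖ * ‖q - z‖ ^ 2 := by
  obtain ⟨hr2, hr12, Ψ, hΨ, h0, h1, hM⟩ := h
  obtain ⟨C, ρ, hC, hρ, hb⟩ := exists_norm_le_mul_sq
    (hΨ.contDiffAt (ball_mem_nhds _ (hr2.trans hr12))) h0 h1
  refine ⟨C, min ρ r₂, hC, lt_min hρ hr2, fun q hq hqz u hu => ?_⟩
  have hq2 : q ∈ M ∩ ball z r₂ :=
    ⟨hq, by rw [mem_ball, dist_eq_norm]; exact hqz.trans_le (min_le_right _ _)⟩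
  rw [hM] at hq2
  obtain ⟨⟨a, -, ha⟩, -⟩ := hq2
  have hqa : q - z = (a : E n) + (Ψ a : E n) := by rw [ha]; abel
  have haq : ‖a‖ ^ 2 ≤ ‖q - z‖ ^ 2 := by
    have : ⟪(a : E n), (Ψ a : E n)⟫_ℝ = 0 :=
      (Submodule.mem_orthogonal _ _).mp (Ψ a).2 _ a.2
    rw [hqa, norm_add_sq_real, this, Submodule.coe_norm]
    nlinarith [sq_nonneg ‖(Ψ a : E n)‖]
  have haq' : ‖a‖ ≤ ‖q - z‖ := le_of_sq_le_sq haq (norm_nonneg _)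
  have hua : ⟪u, (a : E n)⟫_ℝ = 0 := Submodule.inner_left_of_mem_orthogonal a.2 hu
  rw [hqa, inner_add_right, hua, zero_add, ← hqa]
  calc ⟪u, (Ψ a : E n)⟫_ℝ ≤ ‖u‖ * ‖Ψ a‖ := real_inner_le_norm _ _
    _ ≤ ‖u‖ * (C * ‖a‖ ^ 2) := by
      gcongr; exact hb a (haq'.trans_lt (hqz.trans_le (min_le_left _ _)))
    _ ≤ ‖u‖ * (C * ‖q - z‖ ^ 2) := by gcongr
    _ = _ := by ring

theorem IsPatchAt.exists_curve {n : ℕ} {M : Set (E n)} {r₁ r₂ : ℝ} {z : E n}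
    {T : Submodule ℝ (E n)} (h : IsPatchAt M r₁ r₂ z T) {v : E n} (hv : v ∈ T) :
    ∃ γ : ℝ → E n, γ 0 = z ∧ HasDerivAt γ v 0 ∧ ∀ᶠ s in nhds 0, γ s ∈ M := by
  obtain ⟨hr2, hr12, Ψ, hΨ, h0, h1, hM⟩ := h
  have hd : HasFDerivAt Ψ (0 : T →L[ℝ] Tᗮ) 0 := by
    rw [← h1]
    exact ((hΨ.contDiffAt (ball_mem_nhds _ (hr2.trans hr12))).differentiableAt
      (by simp)).hasFDerivAt
  set w : T := ⟨v, hv⟩ with hw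
  have hl : HasDerivAt (fun s : ℝ => s • w) w 0 := by
    simpa using (hasDerivAt_id (0 : ℝ)).smul_const w
  have hΨl : HasDerivAt (fun s : ℝ => Ψ (s • w)) 0 0 := by
    have hd' : HasFDerivAt Ψ (0 : T →L[ℝ] Tᗮ) ((0 : ℝ) • w) := by rwa [zero_smul]
    simpa [Function.comp_def] using hd'.comp_hasDerivAt (0 : ℝ) hl
  have hγ : HasDerivAt (fun s : ℝ => z + s • v + (Ψ (s • w) : E n)) v 0 := by
    have a1 : HasDerivAt (fun s : ℝ => z + s • v) v 0 := by
      simpa using ((hasDerivAt_id (0 : ℝ)).smul_const v).const_add z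
    have a2 : HasDerivAt (fun s : ℝ => (Ψ (s • w) : E n)) 0 0 := by
      simpa [Function.comp_def] using (Tᗮ.subtypeL.hasFDerivAt).comp_hasDerivAt (0 : ℝ) hΨl
    exact (a1.add a2).congr_deriv (add_zero v)
  have hγ0 : z + (0 : ℝ) • v + (Ψ ((0 : ℝ) • w) : E n) = z := by simp [h0]
  refine ⟨_, hγ0, hγ, ?_⟩
  have e1 : ∀ᶠ s in nhds (0 : ℝ), z + s • v + (Ψ (s • w) : E n) ∈ ball z r₂ := by
    refine hγ.continuousAt.eventually_mem ?_
    rw [hγ0]; exact ball_mem_nhds _ hr2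
  have e2 : ∀ᶠ s in nhds (0 : ℝ), s • w ∈ ball (0 : T) r₁ := by
    refine hl.continuousAt.eventually_mem ?_
    rw [zero_smul]; exact ball_mem_nhds _ (hr2.trans hr12)
  filter_upwards [e1, e2] with s hs1 hs2
  have : z + s • v + (Ψ (s • w) : E n) ∈ M ∩ ball z r₂ := by
    rw [hM]; exact ⟨⟨s • w, hs2, rfl⟩, hs1⟩
  exact this.1

/-- The patch gives a small exterior ball touching `M` at `z` in each normal direction, and the
reach enlarges it to radius `τ`. -/
theorem IsPatchAt.hasTangent {n : ℕ} {M : Set (E n)} (hM : IsCompact M) {τ : ℝ} (hτ : 0 < τ)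
    (hreach : ENNReal.ofReal τ ≤ reach M) {r₁ r₂ : ℝ} {z : E n} (hz : z ∈ M)
    {T : Submodule ℝ (E n)} (h : IsPatchAt M r₁ r₂ z T) : HasTangent M τ z T := by
  refine ⟨hz, ?_, fun v hv => h.exists_curve hv⟩
  intro u hu q hq
  rcases eq_or_ne u 0 with rfl | hu0
  · simp
  set e := ‖u‖⁻¹ • u with he
  have hun : 0 < ‖u‖ := norm_pos_iff.mpr hu0
  have he1 : ‖e‖ = 1 := by rw [he, norm_smul, norm_inv, norm_norm, inv_mul_cancel₀ hun.ne']
  have heT : e ∈ Tᗮ := Tᗮ.smul_mem _ hu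
  have hue : u = ‖u‖ • e := by rw [he, smul_smul, mul_inv_cancel₀ hun.ne', one_smul]
  obtain ⟨C, ρ, hC, hρ, hb⟩ := h.exists_inner_le
  -- small enough for `z` to be nearest to `z + r • e` among the points of the patch (`2 r C ≤ 1`)
  -- and among the points at distance at least `ρ` from `z` (`2 r ≤ ρ`)
  set r := min (ρ / 2) (min (τ / 2) (1 / (2 * (C + 1)))) with hr
  have hr0 : 0 < r := by positivity
  have hrρ : r ≤ ρ / 2 := min_le_left _ _
  have hrτ : r ≤ τ / 2 := (min_le_right _ _).trans (min_le_left _ _)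
  have hrC : r ≤ 1 / (2 * (C + 1)) := (min_le_right _ _).trans (min_le_right _ _)
  have hrC' : 2 * r * C ≤ 1 := by
    rw [le_div_iff₀ (by positivity)] at hrC; nlinarith
  have hnear : infDist (z + r • e) M = r := by
    refine le_antisymm ?_ ((le_infDist ⟨z, hz⟩).mpr fun p hp => ?_)
    · have := infDist_le_dist_of_mem (x := z + r • e) hz
      rwa [dist_self_add_left, norm_smul, he1, mul_one, Real.norm_of_nonneg hr0.le] at this
    · rw [dist_eq_norm]
      refine le_of_sq_le_sq ?_ (norm_nonneg _)
      rw [show z + r • e - p = r • e - (p - z) by abel, norm_sub_sq_real, norm_smul, he1,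
        real_inner_smul_left, Real.norm_of_nonneg hr0.le]
      suffices 2 * r * ⟪e, p - z⟫_ℝ ≤ ‖p - z‖ ^ 2 by linarith
      rcases lt_or_ge ‖p - z‖ ρ with hlt | hge
      · have h1 := hb p hp hlt e heT
        rw [he1] at h1
        nlinarith [sq_nonneg ‖p - z‖]
      · have h1 := real_inner_le_norm e (p - z)
        rw [he1] at h1
        nlinarith [norm_nonneg (p - z)]
  have := inner_le_of_nearest hM (existsUnique_nearest_of_le_reach ⟨z, hz⟩ hreach) hz he1 hr0
    (by linarith) hnear hq
  conv_lhs => rw [hue]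
  rw [real_inner_smul_left]
  gcongr

/-! ### Tangent spaces at nearby points -/

theorem inner_starProjection_self_eq_norm_sq {F : Type*}
    [NormedAddCommGroup F] [InnerProductSpace ℝ F] (S : Submodule ℝ F) [S.HasOrthogonalProjection]
    (u : F) : ⟪u, S.starProjection u⟫_ℝ = ‖S.starProjection u‖ ^ 2 := by
  rw [← real_inner_self_eq_norm_sq, S.inner_starProjection_left_eq_right,
    Submodule.starProjection_eq_self_iff.mpr (S.starProjection_apply_mem u)]

section Angle

variable {F : Type*} [NormedAddCommGroup F] [InnerProductSpace ℝ F] [FiniteDimensional ℝ F]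
  {M : Set F} {τ : ℝ}

/-- Federer's estimate of the distance from `q` to the affine tangent space at `z`. -/
theorem HasTangent.norm_normal_le {z : F} {T : Submodule ℝ F} (h : HasTangent M τ z T) {q : F}
    (hq : q ∈ M) (hτ : 0 < τ) :
    ‖(q - z) - T.starProjection (q - z)‖ ≤ ‖q - z‖ ^ 2 / (2 * τ) := by
  set b := (q - z) - T.starProjection (q - z) with hb
  have hbT : b ∈ Tᗮ := Submodule.sub_starProjection_mem_orthogonal _
  have h1 := h.inner_le b hbT q hq
  have h2 : ⟪b, q - z⟫_ℝ = ‖b‖ ^ 2 := by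
    have h3 : q - z = b + T.starProjection (q - z) := by rw [hb]; abel
    have h4 : ⟪b, T.starProjection (q - z)⟫_ℝ = 0 :=
      Submodule.inner_left_of_mem_orthogonal (Submodule.starProjection_apply_mem _ _) hbT
    conv_lhs => rw [h3]
    rw [inner_add_right, h4, real_inner_self_eq_norm_sq, add_zero]
  rw [h2, sq] at h1
  rcases (norm_nonneg b).eq_or_lt with h0 | h0
  · rw [← h0]; positivity
  · exact le_of_mul_le_mul_left h1 h0

/-- Normal vectors of unit length at `x` are almost normal at a nearby point `q`. The penalised
linear function `⟪u, p - q⟫ - θ ‖p - q‖ + ‖p - q‖² / τ`, with `θ = 4 ℓ / τ`, is maximal over the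
points `p` of `M` in the ball of radius `ℓ` about `q` at `p = q` only: on the boundary of the ball
it is negative because `M` is quadratically flat in the direction `u` at `x`, and an interior
critical value away from `q` is negative because the tangential part of `u` there is known. The
derivative at `q` is the claim. -/
theorem norm_starProjection_normal_le_aux (hM : IsCompact M) (hτ : 0 < τ)
    (hall : ∀ p ∈ M, ∃ T : Submodule ℝ F, HasTangent M τ p T)
    {x q : F} {T S : Submodule ℝ F} (hx : HasTangent M τ x T) (hq : HasTangent M τ q S)
    {ℓ : ℝ} (hℓ : 0 < ℓ) (hqx : ‖q - x‖ ≤ ℓ) {u : F} (hu : u ∈ Tᗮ) (hu1 : ‖u‖ = 1) :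
    ‖S.starProjection u‖ ≤ 4 * ℓ / τ := by
  set θ := 4 * ℓ / τ with hθ
  set f : F → ℝ := fun p => ⟪u, p - q⟫_ℝ - θ * ‖p - q‖ + ‖p - q‖ ^ 2 / τ with hf
  have hfq : f q = 0 := by simp [hf]
  have hKc : IsCompact (M ∩ closedBall q ℓ) := hM.inter_right isClosed_closedBall
  have hqK : q ∈ M ∩ closedBall q ℓ := ⟨hq.mem, mem_closedBall_self hℓ.le⟩
  obtain ⟨p, ⟨hpM, hpb⟩, hmax⟩ := hKc.exists_isMaxOn ⟨q, hqK⟩ (f := f) (by fun_prop)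
  have hfp : 0 ≤ f p := hfq ▸ hmax hqK
  rw [mem_closedBall, dist_eq_norm] at hpb
  set ρ := ‖p - q‖ with hρ
  have hfp' : θ * ρ ≤ ⟪u, p - q⟫_ℝ + ρ ^ 2 / τ := by
    simp only [hf] at hfp; linarith
  -- the maximum is attained only at `q`
  have hpq : p = q := by
    by_contra hne
    have hρ0 : 0 < ρ := norm_pos_iff.mpr (sub_ne_zero.mpr hne)
    rcases hpb.lt_or_eq with hlt | heq
    · -- interior maximum: first-order condition along the tangential part of `p - q`
      obtain ⟨P, hP⟩ := hall p hpM
      set v := P.starProjection (p - q) with hv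
      have hvP : v ∈ P := Submodule.starProjection_apply_mem _ _
      obtain ⟨γ, hγ0, hγ, hγM⟩ := hP.exists_curve v hvP
      have hγq : HasDerivAt (fun s => γ s - q) v 0 := hγ.sub_const q
      have hsq : HasDerivAt (fun s => ‖γ s - q‖ ^ 2) (2 * ⟪p - q, v⟫_ℝ) 0 := by
        have := hγq.norm_sq; rwa [hγ0] at this
      have hnorm : HasDerivAt (fun s => ‖γ s - q‖) (⟪p - q, v⟫_ℝ / ρ) 0 := by
        have h1 := hsq.sqrt (by rw [hγ0]; positivity)
        simp only [hγ0, Real.sqrt_sq (norm_nonneg _)] at h1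
        refine h1.congr_deriv ?_
        rw [← hρ]; field_simp
      have hin : HasDerivAt (fun s => ⟪u, γ s - q⟫_ℝ) ⟪u, v⟫_ℝ 0 := by
        simpa using (hasDerivAt_const (0 : ℝ) u).inner ℝ hγq
      have hder : HasDerivAt (fun s => f (γ s))
          (⟪u, v⟫_ℝ - θ * (⟪p - q, v⟫_ℝ / ρ) + 2 * ⟪p - q, v⟫_ℝ / τ) 0 :=
        (hin.sub (hnorm.const_mul θ)).add (hsq.div_const τ)
      have hball : ∀ᶠ s in nhds (0 : ℝ), γ s ∈ ball q ℓ := by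
        refine hγ.continuousAt.eventually_mem ?_
        rw [hγ0]; exact isOpen_ball.mem_nhds (by rwa [mem_ball, dist_eq_norm])
      have hloc : IsLocalMax (fun s => f (γ s)) 0 := by
        filter_upwards [hball, hγM] with s hs1 hs2
        rw [hγ0]
        exact hmax ⟨hs2, ball_subset_closedBall hs1⟩
      have h0 := hloc.hasDerivAt_eq_zero hder
      have hpv : ⟪p - q, v⟫_ℝ = ‖v‖ ^ 2 := by
        exact inner_starProjection_self_eq_norm_sq _ _
      have hvρ : ‖v‖ ≤ ρ := Submodule.norm_starProjection_apply_le _ _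
      have hn : ‖(p - q) - v‖ ≤ ρ ^ 2 / (2 * τ) := by
        have := hP.norm_normal_le hq.mem hτ
        rw [← neg_sub p q, map_neg, norm_neg, ← hv, ← hρ] at this
        rwa [show -(p - q) - -v = -((p - q) - v) by abel, norm_neg] at this
      have h1 : ⟪u, p - q⟫_ℝ ≤ ⟪u, v⟫_ℝ + ρ ^ 2 / (2 * τ) := by
        have h2 : p - q = v + ((p - q) - v) := by abel
        rw [h2, inner_add_right]
        have h3 := real_inner_le_norm u ((p - q) - v)
        rw [hu1, one_mul] at h3
        linarith
      have h2 : ⟪u, v⟫_ℝ = (θ / ρ - 2 / τ) * ‖v‖ ^ 2 := by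
        rw [hpv] at h0
        linear_combination h0
      have h3 : 0 ≤ θ / ρ - 2 / τ := by
        have : 2 / τ ≤ θ / ρ := by
          rw [hθ, div_div, div_le_div_iff₀ hτ (by positivity)]
          nlinarith
        linarith
      have h4 : ⟪u, v⟫_ℝ ≤ (θ / ρ - 2 / τ) * ρ ^ 2 := by
        rw [h2]; gcongr
      have h5 : (θ / ρ - 2 / τ) * ρ ^ 2 = θ * ρ - 2 * (ρ ^ 2 / τ) := by field_simp
      have h6 : ρ ^ 2 / (2 * τ) = ρ ^ 2 / τ / 2 := by field_simp
      have h7 : 0 < ρ ^ 2 / τ := by positivity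
      rw [h6] at h1
      linarith
    · have h1 := hx.inner_le u hu p hpM
      have h2 := hx.inner_le (-u) (neg_mem hu) q hq.mem
      have h3 : ‖p - x‖ ≤ 2 * ℓ := by
        have := norm_add_le (p - q) (q - x)
        rw [sub_add_sub_cancel] at this
        linarith
      rw [hu1, one_mul] at h1
      rw [norm_neg, hu1, one_mul, inner_neg_left] at h2
      have h4 : ⟪u, p - q⟫_ℝ = ⟪u, p - x⟫_ℝ - ⟪u, q - x⟫_ℝ := by
        rw [← inner_sub_right]; congr 1; abel
      have h5 : ‖p - x‖ ^ 2 / (2 * τ) ≤ (2 * ℓ) ^ 2 / (2 * τ) := by gcongr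
      have h6 : ‖q - x‖ ^ 2 / (2 * τ) ≤ ℓ ^ 2 / (2 * τ) := by gcongr
      have h7 : (2 * ℓ) ^ 2 / (2 * τ) = 2 * (ℓ ^ 2 / τ) := by field_simp
      have h8 : ℓ ^ 2 / (2 * τ) = ℓ ^ 2 / τ / 2 := by field_simp
      have h9 : θ * ρ = 4 * (ℓ ^ 2 / τ) := by rw [heq, hθ]; field_simp
      have h10 : 0 < ℓ ^ 2 / τ := by positivity
      rw [heq] at hfp' h9
      linarith
  subst hpq
  -- at the maximum `q`, the slope of `⟪u, ·⟫` along its own tangential part is at most `θ`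
  set v := S.starProjection u with hv
  have hvS : v ∈ S := Submodule.starProjection_apply_mem _ _
  obtain ⟨γ, hγ0, hγ, hγM⟩ := hq.exists_curve v hvS
  have hγq : HasDerivAt (fun s => γ s - p) v 0 := hγ.sub_const p
  have hball : ∀ᶠ s in nhds (0 : ℝ), γ s ∈ ball p ℓ := by
    refine hγ.continuousAt.eventually_mem ?_
    rw [hγ0]; exact ball_mem_nhds _ hℓ
  have hev : ∀ᶠ s in nhds (0 : ℝ), ⟪u, γ s - p⟫_ℝ ≤ θ * ‖γ s - p‖ := by
    filter_upwards [hball, hγM] with s hs1 hs2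
    have h1 : f (γ s) ≤ f p := hmax ⟨hs2, ball_subset_closedBall hs1⟩
    rw [hfq] at h1
    have : 0 ≤ ‖γ s - p‖ ^ 2 / τ := by positivity
    simp only [hf] at h1
    linarith
  have hslope : Filter.Tendsto (fun s : ℝ => s⁻¹ • (γ s - p)) (nhdsWithin 0 (Ioi 0)) (nhds v) := by
    have := hγ.tendsto_slope_zero_right
    simpa [hγ0] using this
  have hle : ⟪u, v⟫_ℝ ≤ θ * ‖v‖ := by
    refine le_of_tendsto_of_tendsto (tendsto_const_nhds.inner hslope)
      (hslope.norm.const_mul θ) ?_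
    filter_upwards [nhdsWithin_le_nhds hev, self_mem_nhdsWithin] with s hs1 hs2
    rw [mem_Ioi] at hs2
    rw [real_inner_smul_right, norm_smul, norm_inv, Real.norm_of_nonneg hs2.le]
    have := mul_le_mul_of_nonneg_left hs1 (inv_pos.mpr hs2).le
    linarith
  have huv : ⟪u, v⟫_ℝ = ‖v‖ ^ 2 := by
    exact inner_starProjection_self_eq_norm_sq _ _
  rw [huv, sq] at hle
  rcases (norm_nonneg v).eq_or_lt with h0 | h0
  · rw [← h0]; positivity
  · exact le_of_mul_le_mul_right hle h0

/-- Normal vectors at `x` are almost normal at every point `q` of `M` with `‖q - x‖ ≤ ℓ`. Here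
`q = x` is allowed: two tangent spaces at the same point are compared by letting `ℓ` tend to `0`. -/
theorem norm_starProjection_normal_le (hM : IsCompact M) (hτ : 0 < τ)
    (hall : ∀ p ∈ M, ∃ T : Submodule ℝ F, HasTangent M τ p T)
    {x q : F} {T S : Submodule ℝ F} (hx : HasTangent M τ x T) (hq : HasTangent M τ q S)
    {ℓ : ℝ} (hℓ : 0 < ℓ) (hqx : ‖q - x‖ ≤ ℓ) {u : F} (hu : u ∈ Tᗮ) :
    ‖S.starProjection u‖ ≤ 4 * ℓ / τ * ‖u‖ := by
  rcases eq_or_ne u 0 with rfl | hu0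
  · simp
  have hun : 0 < ‖u‖ := norm_pos_iff.mpr hu0
  have := norm_starProjection_normal_le_aux hM hτ hall hx hq hℓ hqx
    (Tᗮ.smul_mem ‖u‖⁻¹ hu) (by rw [norm_smul, norm_inv, norm_norm, inv_mul_cancel₀ hun.ne'])
  rw [map_smul, norm_smul, norm_inv, norm_norm] at this
  rwa [inv_mul_le_iff₀ hun, mul_comm] at this

/-- Near `x` the projection of `M` to the tangent space at `x` is onto. At a point `q` of `M` whose
projection is closest to `a`, the error `g` is tangent at `x` and normal at `q`, hence zero. -/
theorem HasTangent.exists_starProjection_eq (hM : IsCompact M) (hτ : 0 < τ)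
    (hall : ∀ p ∈ M, ∃ T : Submodule ℝ F, HasTangent M τ p T)
    {x : F} {T : Submodule ℝ F} (hx : HasTangent M τ x T) {a : F} (ha : a ∈ T)
    (haτ : 16 * ‖a‖ ≤ τ) : ∃ q ∈ M, T.starProjection (q - x) = a ∧ ‖q - x‖ ≤ 3 * ‖a‖ := by
  rcases eq_or_ne a 0 with rfl | ha0
  · exact ⟨x, hx.mem, by simp, by simp⟩
  have hs : 0 < ‖a‖ := norm_pos_iff.mpr ha0
  have hKc : IsCompact (M ∩ closedBall x (3 * ‖a‖)) := hM.inter_right isClosed_closedBall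
  have hxK : x ∈ M ∩ closedBall x (3 * ‖a‖) := ⟨hx.mem, mem_closedBall_self (by positivity)⟩
  obtain ⟨q, ⟨hqM, hqb⟩, hmin⟩ := hKc.exists_isMinOn ⟨x, hxK⟩
    (f := fun q => ‖T.starProjection (q - x) - a‖ ^ 2) (by fun_prop)
  rw [mem_closedBall, dist_eq_norm] at hqb
  refine ⟨q, hqM, ?_, hqb⟩
  by_contra hne
  set g := T.starProjection (q - x) - a with hg
  have hg0 : g ≠ 0 := sub_ne_zero.mpr hne
  have hgT : g ∈ T := T.sub_mem (Submodule.starProjection_apply_mem _ _) ha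
  have hga : ‖g‖ ≤ ‖a‖ := by
    have h1 : ‖g‖ ^ 2 ≤ ‖a‖ ^ 2 := by
      have := hmin hxK
      simpa only [mem_ofPred_eq, sub_self, map_zero, zero_sub, norm_neg] using this
    exact le_of_sq_le_sq h1 (norm_nonneg _)
  -- the constraint `‖q - x‖ ≤ 3 ‖a‖` is inactive
  have hlt : ‖q - x‖ < 3 * ‖a‖ := by
    have h1 : ‖T.starProjection (q - x)‖ ≤ 2 * ‖a‖ := by
      have := norm_add_le g a
      rw [hg, sub_add_cancel] at this
      linarith
    have h2 := hx.norm_normal_le hqM hτ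
    have h3 : ‖q - x‖ ^ 2 / (2 * τ) ≤ (3 * ‖a‖) ^ 2 / (2 * τ) := by gcongr
    have h4 : (3 * ‖a‖) ^ 2 / (2 * τ) ≤ ‖a‖ / 2 := by
      rw [div_le_div_iff₀ (by positivity) two_pos]; nlinarith
    have h5 := norm_add_le (T.starProjection (q - x)) ((q - x) - T.starProjection (q - x))
    rw [add_sub_cancel] at h5
    linarith
  obtain ⟨S, hS⟩ := hall q hqM
  have hgS : g ∈ Sᗮ := by
    rw [Submodule.mem_orthogonal']
    intro v hv
    obtain ⟨γ, hγ0, hγ, hγM⟩ := hS.exists_curve v hv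
    have h1 : HasDerivAt (fun s => T.starProjection (γ s - x) - a) (T.starProjection v) 0 := by
      have := (T.starProjection.hasFDerivAt).comp_hasDerivAt (0 : ℝ) (hγ.sub_const x)
      exact this.sub_const a
    have h2 : HasDerivAt (fun s => ‖T.starProjection (γ s - x) - a‖ ^ 2)
        (2 * ⟪g, T.starProjection v⟫_ℝ) 0 := by
      have := h1.norm_sq; rwa [hγ0, ← hg] at this
    have hball : ∀ᶠ s in nhds (0 : ℝ), γ s ∈ ball x (3 * ‖a‖) := by
      refine hγ.continuousAt.eventually_mem ?_
      rw [hγ0]; exact isOpen_ball.mem_nhds (by rwa [mem_ball, dist_eq_norm])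
    have hloc : IsLocalMin (fun s => ‖T.starProjection (γ s - x) - a‖ ^ 2) 0 := by
      filter_upwards [hball, hγM] with s hs1 hs2
      rw [hγ0]
      exact hmin ⟨hs2, ball_subset_closedBall hs1⟩
    have h0 := hloc.hasDerivAt_eq_zero h2
    rw [← Submodule.inner_starProjection_left_eq_right,
      Submodule.starProjection_eq_self_iff.mpr hgT] at h0
    linarith
  have h1 := norm_starProjection_normal_le hM hτ hall hS hx (ℓ := 3 * ‖a‖) (by positivity)
    (by rwa [norm_sub_rev]) hgS
  rw [Submodule.starProjection_eq_self_iff.mpr hgT] at h1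
  have h2 : 4 * (3 * ‖a‖) / τ < 1 := by rw [div_lt_one hτ]; linarith
  have h3 : 0 < ‖g‖ := norm_pos_iff.mpr hg0
  nlinarith

end Angle

/-! ### Rotations between nearby subspaces -/

section Rotation

variable {F : Type*} [NormedAddCommGroup F] [InnerProductSpace ℝ F]

theorem reflection_orthogonal_singleton_apply {a : F} (ha : ‖a‖ = 1) (v : F) :
    (ℝ ∙ a)ᗮ.reflection v = v - (2 * ⟪a, v⟫_ℝ) • a := by
  rw [Submodule.reflection_orthogonal_apply, Submodule.reflection_singleton_apply, ha]
  simp [two_smul, add_smul, two_mul]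

theorem det_trans_toLinearEquiv (R S : F ≃ₗᵢ[ℝ] F) :
    LinearMap.det ((R.trans S).toLinearEquiv : F →ₗ[ℝ] F) =
      LinearMap.det (S.toLinearEquiv : F →ₗ[ℝ] F) *
        LinearMap.det (R.toLinearEquiv : F →ₗ[ℝ] F) := by
  rw [← LinearMap.det_comp]; rfl

variable [FiniteDimensional ℝ F]

theorem det_reflection_orthogonal_singleton {a : F} (ha : ‖a‖ = 1) :
    LinearMap.det ((ℝ ∙ a)ᗮ.reflection.toLinearEquiv : F →ₗ[ℝ] F) = -1 := by
  have h0 : a ≠ 0 := by rintro rfl; simp at ha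
  have := (ℝ ∙ a)ᗮ.det_reflection
  rw [Submodule.orthogonal_orthogonal, finrank_span_singleton h0, pow_one] at this
  exact this

/-- The rotation taking `a` to `b` in their common plane, as the product of the reflections in the
hyperplanes orthogonal to `a` and to `a + b`. -/
theorem exists_rotation_of_norm_eq_one {a b : F} (ha : ‖a‖ = 1) (hb : ‖b‖ = 1)
    (hab : ‖a - b‖ < 2) :
    ∃ R : F ≃ₗᵢ[ℝ] F, LinearMap.det (R.toLinearEquiv : F →ₗ[ℝ] F) = 1 ∧ R a = b ∧
      (∀ s, ⟪a, s⟫_ℝ = 0 → ⟪b, s⟫_ℝ = 0 → R s = s) ∧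
      ∀ v, ‖R v - v‖ ≤ 4 * ‖a - b‖ * ‖v‖ := by
  have hsum : 2 - ‖a - b‖ ≤ ‖a + b‖ := by
    have h1 : ‖a + b + (a - b)‖ ≤ ‖a + b‖ + ‖a - b‖ := norm_add_le _ _
    rw [show a + b + (a - b) = (2 : ℝ) • a by rw [two_smul]; abel, norm_smul, ha] at h1
    norm_num at h1; linarith
  have hpos : 0 < ‖a + b‖ := by linarith
  set m := ‖a + b‖⁻¹ • (a + b) with hm
  have hm1 : ‖m‖ = 1 := by rw [hm, norm_smul, norm_inv, norm_norm, inv_mul_cancel₀ hpos.ne']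
  have ham : ‖a - m‖ ≤ ‖a - b‖ := by
    have h1 : a - m = (1 / 2 : ℝ) • (a - b) + (‖a + b‖ / 2 - 1) • m := by
      have h2 : a + b = ‖a + b‖ • m := by
        rw [hm, smul_smul, mul_inv_cancel₀ hpos.ne', one_smul]
      have h3 : (‖a + b‖ / 2 - 1) • m = (1 / 2 : ℝ) • (a + b) - m := by
        have : (‖a + b‖ / 2 - 1) • m = (1 / 2 : ℝ) • (‖a + b‖ • m) - m := by module
        rw [this, ← h2]
      rw [h3]; module
    have h2 : ‖a + b‖ ≤ 2 := by have := norm_add_le a b; linarith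
    have h3 := norm_add_le ((1 / 2 : ℝ) • (a - b)) ((‖a + b‖ / 2 - 1) • m)
    rw [← h1, norm_smul, norm_smul, hm1, Real.norm_of_nonneg (by norm_num), Real.norm_eq_abs,
      abs_of_nonpos (by linarith)] at h3
    linarith
  refine ⟨((ℝ ∙ a)ᗮ.reflection).trans ((ℝ ∙ m)ᗮ.reflection), ?_, ?_, ?_, ?_⟩
  · rw [det_trans_toLinearEquiv, det_reflection_orthogonal_singleton ha,
      det_reflection_orthogonal_singleton hm1]; norm_num
  · rw [LinearIsometryEquiv.trans_apply, Submodule.reflection_orthogonalComplement_singleton_eq_neg]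
    have h1 : ‖-a‖ = ‖b‖ := by rw [norm_neg, ha, hb]
    have h2 := Submodule.reflection_sub h1
    have h3 : (ℝ ∙ (-a - b)) = ℝ ∙ m := by
      rw [show -a - b = (-‖a + b‖) • m by
        rw [hm, smul_smul, neg_mul, mul_inv_cancel₀ hpos.ne', neg_one_smul]; abel]
      exact Submodule.span_singleton_smul_eq (IsUnit.mk0 _ (neg_ne_zero.mpr hpos.ne')) m
    simp only [h3] at h2
    exact h2
  · intro s hs1 hs2
    have hs3 : ⟪m, s⟫_ℝ = 0 := by
      rw [hm, real_inner_smul_left, inner_add_left, hs1, hs2]; simp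
    rw [LinearIsometryEquiv.trans_apply, reflection_orthogonal_singleton_apply ha,
      reflection_orthogonal_singleton_apply hm1]
    simp [hs1, hs3]
  · intro v
    rw [LinearIsometryEquiv.trans_apply]
    set w := (ℝ ∙ a)ᗮ.reflection v with hw
    have hv : v = (ℝ ∙ a)ᗮ.reflection w := by rw [hw, Submodule.reflection_reflection]
    have hwv : ‖w‖ = ‖v‖ := LinearIsometryEquiv.norm_map _ _
    have h1 : (ℝ ∙ m)ᗮ.reflection w - v =
        (2 * ⟪a - m, w⟫_ℝ) • a + (2 * ⟪m, w⟫_ℝ) • (a - m) := by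
      rw [hv, reflection_orthogonal_singleton_apply ha, reflection_orthogonal_singleton_apply hm1,
        inner_sub_left]
      module
    rw [h1]
    have h2 : |⟪a - m, w⟫_ℝ| ≤ ‖a - b‖ * ‖v‖ := by
      rw [← hwv]
      exact (abs_real_inner_le_norm _ _).trans (by gcongr)
    have h3 : |⟪m, w⟫_ℝ| ≤ ‖v‖ := by
      have := abs_real_inner_le_norm m w
      rwa [hm1, one_mul, hwv] at this
    calc _ ≤ ‖(2 * ⟪a - m, w⟫_ℝ) • a‖ + ‖(2 * ⟪m, w⟫_ℝ) • (a - m)‖ := norm_add_le _ _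
      _ = 2 * |⟪a - m, w⟫_ℝ| + 2 * |⟪m, w⟫_ℝ| * ‖a - m‖ := by
        rw [norm_smul, norm_smul, ha, Real.norm_eq_abs, Real.norm_eq_abs, abs_mul, abs_mul]
        norm_num
      _ ≤ 2 * (‖a - b‖ * ‖v‖) + 2 * ‖v‖ * ‖a - b‖ := by gcongr
      _ = _ := by ring

/-- The constant for which an orthonormal `k`-frame at distance at most `δ` from a subspace is moved
into it by a rotation at distance at most `rotConst k * δ` from the identity. -/
def rotConst : ℕ → ℝ
  | 0 => 1
  | k + 1 => 9 * rotConst k + 8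

theorem one_le_rotConst : ∀ k, 1 ≤ rotConst k
  | 0 => le_rfl
  | k + 1 => by have := one_le_rotConst k; rw [rotConst]; linarith

/-- An orthonormal frame close to `T` is moved into `T` by a proper rotation close to the identity,
one vector at a time. -/
theorem exists_rotation_frame (T : Submodule ℝ F) {δ : ℝ} (hδ : 0 ≤ δ) :
    ∀ (k : ℕ) (e : Fin k → F), Orthonormal ℝ e → (∀ i, ‖e i - T.starProjection (e i)‖ ≤ δ) →
      rotConst k * δ ≤ 1 →
      ∃ R : F ≃ₗᵢ[ℝ] F, LinearMap.det (R.toLinearEquiv : F →ₗ[ℝ] F) = 1 ∧ (∀ i, R (e i) ∈ T) ∧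
        ∀ v, ‖R v - v‖ ≤ rotConst k * δ * ‖v‖ := by
  intro k
  induction k with
  | zero =>
    intro e _ _ _
    refine ⟨LinearIsometryEquiv.refl ℝ F, ?_, fun i => i.elim0, fun v => ?_⟩
    · exact LinearMap.det_id
    · rw [show LinearIsometryEquiv.refl ℝ F v = v from rfl, sub_self, norm_zero]
      exact mul_nonneg (mul_nonneg (zero_le_one.trans (one_le_rotConst 0)) hδ) (norm_nonneg _)
  | succ k ih =>
    intro e he hnear hsmall
    have hC := one_le_rotConst k
    have hrec : rotConst (k + 1) = 9 * rotConst k + 8 := rfl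
    rw [hrec] at hsmall ⊢
    obtain ⟨R, hRdet, hRT, hRv⟩ := ih (fun i => e i.castSucc)
      (he.comp _ (Fin.castSucc_injective k)) (fun i => hnear _) (by nlinarith)
    set l := e (Fin.last k) with hl
    have hl1 : ‖l‖ = 1 := he.1 _
    set a := R l with ha
    have ha1 : ‖a‖ = 1 := by rw [ha, R.norm_map, hl1]
    set p := T.starProjection a with hp
    have hpT : p ∈ T := T.starProjection_apply_mem a
    have hap : ‖a - p‖ ≤ (rotConst k + 1) * δ := by
      have h1 : ‖a - p‖ ≤ ‖a - T.starProjection l‖ := by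
        rw [hp, T.starProjection_minimal]
        exact ciInf_le ⟨0, by rintro _ ⟨w, rfl⟩; exact norm_nonneg _⟩
          (⟨_, T.starProjection_apply_mem l⟩ : T)
      have h2 : ‖a - T.starProjection l‖ ≤ ‖a - l‖ + ‖l - T.starProjection l‖ := by
        have := norm_add_le (a - l) (l - T.starProjection l)
        rwa [sub_add_sub_cancel] at this
      have h3 := hRv l
      rw [hl1, mul_one] at h3
      have h4 := hnear (Fin.last k)
      linarith
    have hp1 : 1 - ‖p‖ ≤ ‖a - p‖ := by rw [← ha1]; exact norm_sub_norm_le _ _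
    have hpa : ‖p‖ ≤ 1 := by rw [← ha1]; exact T.norm_starProjection_apply_le a
    have hp0 : 0 < ‖p‖ := by nlinarith
    set b := ‖p‖⁻¹ • p with hb
    have hb1 : ‖b‖ = 1 := by rw [hb, norm_smul, norm_inv, norm_norm, inv_mul_cancel₀ hp0.ne']
    have hbT : b ∈ T := T.smul_mem _ hpT
    have hpb : ‖p - b‖ = 1 - ‖p‖ := by
      have : p - b = (‖p‖ - 1) • b := by
        rw [sub_smul, one_smul, hb, smul_smul, mul_inv_cancel₀ hp0.ne', one_smul]
      rw [this, norm_smul, hb1, mul_one, Real.norm_eq_abs, abs_of_nonpos (by linarith)]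
      ring
    have hab : ‖a - b‖ ≤ 2 * (rotConst k + 1) * δ := by
      have := norm_add_le (a - p) (p - b)
      rw [sub_add_sub_cancel] at this
      linarith
    obtain ⟨S, hSdet, hSa, hSfix, hSv⟩ := exists_rotation_of_norm_eq_one ha1 hb1 (by nlinarith)
    refine ⟨R.trans S, ?_, ?_, ?_⟩
    · rw [det_trans_toLinearEquiv, hRdet, hSdet, one_mul]
    · intro i
      rw [LinearIsometryEquiv.trans_apply]
      refine Fin.lastCases ?_ (fun j => ?_) i
      · rw [← hl, ← ha, hSa]; exact hbT
      -- the new rotation fixes the vectors already placed in `T`: they are orthogonal to `a`,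
      -- hence to its projection to `T`
      · have h1 : ⟪a, R (e j.castSucc)⟫_ℝ = 0 := by
          rw [ha, R.inner_map_map]
          exact he.2 (Fin.castSucc_lt_last j).ne'
        have h2 : ⟪b, R (e j.castSucc)⟫_ℝ = 0 := by
          rw [hb, real_inner_smul_left, hp, T.inner_starProjection_left_eq_right,
            Submodule.starProjection_eq_self_iff.mpr (hRT j), h1, mul_zero]
        rw [hSfix _ h1 h2]
        exact hRT j
    · intro v
      rw [LinearIsometryEquiv.trans_apply]
      have h1 := norm_add_le (S (R v) - R v) (R v - v)
      rw [sub_add_sub_cancel] at h1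
      have h2 := hSv (R v)
      rw [R.norm_map] at h2
      have h3 := hRv v
      have h4 : 4 * ‖a - b‖ * ‖v‖ ≤ 4 * (2 * (rotConst k + 1) * δ) * ‖v‖ := by gcongr
      linarith

/-- Two subspaces of dimension `d` at a small angle are carried one to the other by a proper
rotation close to the identity. -/
theorem exists_rotation_map_eq {T S : Submodule ℝ F} {d : ℕ} (hT : Module.finrank ℝ T = d)
    (hS : Module.finrank ℝ S = d) {δ : ℝ} (hδ : 0 ≤ δ)
    (hTS : ∀ v ∈ T, ‖v - S.starProjection v‖ ≤ δ * ‖v‖) (hsmall : rotConst d * δ ≤ 1) :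
    ∃ R : F ≃ₗᵢ[ℝ] F, LinearMap.det (R.toLinearEquiv : F →ₗ[ℝ] F) = 1 ∧
      T.map (R.toLinearEquiv : F →ₗ[ℝ] F) = S ∧ ∀ v, ‖R v - v‖ ≤ rotConst d * δ * ‖v‖ := by
  set e := (stdOrthonormalBasis ℝ T).reindex (finCongr hT) with he
  have hon : Orthonormal ℝ (fun i => (e i : F)) :=
    e.orthonormal.comp_linearIsometry T.subtypeₗᵢ
  obtain ⟨R, hdet, hRT, hRv⟩ := exists_rotation_frame S hδ d (fun i => (e i : F)) hon
    (fun i => by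
      have := hTS (e i) (e i).2
      rwa [hon.1 i, mul_one] at this) hsmall
  refine ⟨R, hdet, ?_, hRv⟩
  refine Submodule.eq_of_le_of_finrank_eq ?_ ?_
  · rintro _ ⟨v, hv, rfl⟩
    have h1 : v = ∑ i, ⟪(e i : F), v⟫_ℝ • (e i : F) := by
      have := congrArg Subtype.val (e.sum_repr' ⟨v, hv⟩)
      simpa using this.symm
    rw [h1, map_sum]
    refine S.sum_mem fun i _ => ?_
    rw [map_smul]
    exact S.smul_mem _ (hRT i)
  · rw [hS, ← hT]
    exact LinearEquiv.finrank_map_eq R.toLinearEquiv T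

end Rotation

/-! ### Local volume -/

/-- Near `x` the manifold has at least the volume of a ball of its tangent space, because the
orthogonal projection to that space does not increase volume and covers the ball. -/
theorem volume_ball_le_vol {n d : ℕ} {M : Set (E n)} {τ : ℝ} (hM : IsCompact M) (hτ : 0 < τ)
    (hall : ∀ p ∈ M, ∃ T : Submodule ℝ (E n), HasTangent M τ p T)
    {x : E n} {T : Submodule ℝ (E n)} (hx : HasTangent M τ x T) (hT : Module.finrank ℝ T = d)
    {s : ℝ} (hsτ : 16 * s ≤ τ) :
    volume (ball (0 : EuclideanSpace ℝ (Fin d)) s) ≤ vol d (M ∩ ball x (3 * s)) := by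
  set b := (stdOrthonormalBasis ℝ T).reindex (finCongr hT) with hb
  set L : E n → EuclideanSpace ℝ (Fin d) :=
    fun q => b.repr (T.orthogonalProjectionOnto (q - x)) with hL
  have hLip : LipschitzWith 1 L := by
    refine LipschitzWith.of_dist_le_mul fun p q => ?_
    rw [NNReal.coe_one, one_mul, hL, LinearIsometryEquiv.dist_map, dist_eq_norm, ← map_sub,
      sub_sub_sub_cancel_right, dist_eq_norm]
    exact T.norm_orthogonalProjectionOnto_apply_le _
  have hsub : ball (0 : EuclideanSpace ℝ (Fin d)) s ⊆ L '' (M ∩ ball x (3 * s)) := by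
    intro y hy
    set a : T := b.repr.symm y with ha
    have hay : ‖(a : E n)‖ = ‖y‖ := by rw [← Submodule.coe_norm, ha, LinearIsometryEquiv.norm_map]
    have has : ‖(a : E n)‖ < s := by rw [hay]; exact mem_ball_zero_iff.mp hy
    obtain ⟨q, hqM, hq1, hq2⟩ := hx.exists_starProjection_eq hM hτ hall a.2 (by linarith)
    refine ⟨q, ⟨hqM, ?_⟩, ?_⟩
    · rw [mem_ball, dist_eq_norm]; linarith
    · have : T.orthogonalProjectionOnto (q - x) = a := Subtype.ext hq1
      simp only [hL, this, ha, LinearIsometryEquiv.apply_symm_apply]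
  rw [← EuclideanSpace.euclideanHausdorffMeasure_eq_volume]
  refine (measure_mono hsub).trans ?_
  rw [vol, Measure.euclideanHausdorffMeasure_def, Measure.euclideanHausdorffMeasure_def,
    Measure.smul_apply, Measure.smul_apply]
  have := hLip.hausdorffMeasure_image_le (d := d) (by positivity) (M ∩ ball x (3 * s))
  rw [ENNReal.coe_one, ENNReal.one_rpow, one_mul] at this
  gcongr

/-! ### Cylinder packets -/

section Cylinders

variable {n d : ℕ} {τbar : ℝ}

theorem Cylinder.mem_carrier_of_norm_le (C : Cylinder n d) {y : E n}
    (hy : ‖y - C.center‖ ≤ τbar) : y ∈ C.carrier τbar := by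
  refine ⟨(C.dir.norm_starProjection_apply_le _).trans hy, le_trans ?_ hy⟩
  rw [← Submodule.starProjection_orthogonal_val]
  exact C.dirᗮ.norm_starProjection_apply_le _

/-- A cylinder lies in the ball of radius `√2 * τbar` about its centre, and `√2 ≤ 3 / 2`. -/
theorem Cylinder.norm_le_of_mem_carrier (C : Cylinder n d) {y : E n}
    (hy : y ∈ C.carrier τbar) (hτ : 0 ≤ τbar) : ‖y - C.center‖ ≤ 3 / 2 * τbar := by
  obtain ⟨h1, h2⟩ := hy
  have h3 := C.dir.norm_sq_eq_add_norm_sq_starProjection (y - C.center)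
  rw [Submodule.starProjection_orthogonal_val] at h3
  have h4 := pow_le_pow_left₀ (norm_nonneg _) h1 2
  have h5 := pow_le_pow_left₀ (norm_nonneg _) h2 2
  refine le_of_sq_le_sq ?_ (by positivity)
  nlinarith

/-- A rotation about the centre of `C` with linear part mapping the direction of `C` to that of
`C'`, followed by the translation by `t`, takes `C` to the translate of `C'` by `w` as soon as it
does so for the centres. -/
theorem image_rotAbout_add {C C' : Cylinder n d} {R : E n ≃ₗᵢ[ℝ] E n} {t w : E n}
    (hR : C.dir.map (R.toLinearEquiv : E n →ₗ[ℝ] E n) = C'.dir)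
    (ht : C.center + t = C'.center + w) :
    (fun v => rotAbout C.center R v + t) '' C.carrier τbar =
        (fun v => v + w) '' C'.carrier τbar ∧
      (fun v => rotAbout C.center R v + t) '' C.cross τbar =
        (fun v => v + w) '' C'.cross τbar := by
  have hproj : ∀ u, C'.dir.starProjection (R u) = R (C.dir.starProjection u) := fun u => by
    rw [← hR, Submodule.starProjection_map_apply, R.symm_apply_apply]
  have hmem : ∀ u, R u ∈ C'.dir ↔ u ∈ C.dir := fun u => by
    rw [← Submodule.starProjection_eq_self_iff, hproj, R.injective.eq_iff,
      Submodule.starProjection_eq_self_iff]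
  -- `v ↦ C'.center + R (v - C.center)` carries the sets of `C` onto those of `C'`
  have hfwd : ∀ v, rotAbout C.center R v + t = C'.center + R (v - C.center) + w := fun v => by
    rw [rotAbout, add_right_comm, ht, add_right_comm]
  have himg : ∀ A A' : Set (E n), (∀ v, C'.center + R (v - C.center) ∈ A' ↔ v ∈ A) →
      (fun v => rotAbout C.center R v + t) '' A = (fun v => v + w) '' A' := by
    intro A A' hA
    ext y
    constructor
    · rintro ⟨v, hv, rfl⟩
      exact ⟨_, (hA v).mpr hv, (hfwd v).symm⟩
    · rintro ⟨z, hz, rfl⟩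
      have hz' : C'.center + R (C.center + R.symm (z - C'.center) - C.center) = z := by
        rw [add_sub_cancel_left, R.apply_symm_apply, add_sub_cancel]
      refine ⟨C.center + R.symm (z - C'.center), (hA _).mp (by rwa [hz']), ?_⟩
      simp only [hfwd, hz']
  refine ⟨himg _ _ fun v => ?_, himg _ _ fun v => ?_⟩
  · simp only [Cylinder.carrier, mem_ofPred_eq, add_sub_cancel_left, hproj, ← map_sub,
      R.norm_map]
  · simp only [Cylinder.cross, mem_ofPred_eq, add_sub_cancel_left, hmem, R.norm_map]

end Cylinders

/-- The factor `24 ^ d / ω_d` of the packing bound, where `ω_d` is the volume of the unit ball of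
`ℝᵈ`. -/
noncomputable def packConst (d : ℕ) : ℝ :=
  24 ^ d / (volume (ball (0 : EuclideanSpace ℝ (Fin d)) 1)).toReal

/-- The packing bound: by the separation hypothesis the balls of radius `τbar / 8` about the centres
are disjoint, and each contains at least the volume of a `d`-ball of radius `τbar / 24` from `M`. -/
theorem card_le_mul_vol {n d m : ℕ} {M : Set (E n)} {τ τbar : ℝ} (hM : IsCompact M)
    (hτ : 0 < τ) (hτbar : 0 < τbar) (hle : τbar ≤ τ)
    (hall : ∀ p ∈ M, ∃ T : Submodule ℝ (E n), HasTangent M τ p T)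
    {x : Fin m → E n} {T : Fin m → Submodule ℝ (E n)} (hx : ∀ i, HasTangent M τ (x i) (T i))
    (hT : ∀ i, Module.finrank ℝ (T i) = d)
    (hsep : ∀ i j, i ≠ j → τbar / 2.9 ≤ ‖x i - x j‖) {K : ℝ} (hK : packConst d ≤ K) :
    (m : ℝ≥0∞) ≤ ENNReal.ofReal (K / τbar ^ d) * vol d M := by
  set κ := volume (ball (0 : EuclideanSpace ℝ (Fin d)) 1) with hκ
  have hκ0 : 0 < κ := measure_ball_pos _ _ one_pos
  have hκt : κ ≠ ⊤ := measure_ball_lt_top.ne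
  have hκr : 0 < κ.toReal := ENNReal.toReal_pos hκ0.ne' hκt
  have hdisj : Pairwise (Function.onFun Disjoint fun i => M ∩ ball (x i) (3 * (τbar / 24))) := by
    intro i j hij
    refine Disjoint.mono inter_subset_right inter_subset_right (ball_disjoint_ball ?_)
    rw [dist_eq_norm]
    refine le_trans ?_ (hsep i j hij)
    rw [le_div_iff₀ (by norm_num)]
    linarith
  have hsum : ∑ i, vol d (M ∩ ball (x i) (3 * (τbar / 24))) ≤ vol d M := by
    have h1 := measure_iUnion (μ := Measure.euclideanHausdorffMeasure d) hdisj
      fun i => hM.isClosed.measurableSet.inter measurableSet_ball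
    rw [tsum_fintype] at h1
    simp only [vol]
    rw [← h1]
    exact measure_mono (iUnion_subset fun i => inter_subset_left)
  have hone : ∀ i, ENNReal.ofReal ((τbar / 24) ^ d) * κ ≤
      vol d (M ∩ ball (x i) (3 * (τbar / 24))) := fun i => by
    have h1 := volume_ball_le_vol hM hτ hall (hx i) (hT i) (s := τbar / 24) (by linarith)
    rwa [Measure.addHaar_ball_of_pos _ _ (by positivity), finrank_euclideanSpace_fin] at h1
  have hcard : (m : ℝ≥0∞) * (ENNReal.ofReal ((τbar / 24) ^ d) * κ) ≤ vol d M := by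
    refine le_trans ?_ hsum
    have := Finset.sum_le_sum fun i (_ : i ∈ Finset.univ) => hone i
    simpa using this
  have hunit : 1 ≤ ENNReal.ofReal (K / τbar ^ d) * (ENNReal.ofReal ((τbar / 24) ^ d) * κ) := by
    have hK0 : 0 ≤ K := le_trans (by rw [packConst]; positivity) hK
    rw [← ENNReal.ofReal_toReal hκt, ← ENNReal.ofReal_mul (by positivity),
      ← ENNReal.ofReal_mul (by positivity), ENNReal.one_le_ofReal]
    have h1 : K / τbar ^ d * ((τbar / 24) ^ d * κ.toReal) = K * (κ.toReal / 24 ^ d) := by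
      rw [div_pow]; field_simp
    rw [h1]
    have h2 : packConst d * (κ.toReal / 24 ^ d) = 1 := by
      rw [packConst, ← hκ]; field_simp
    rw [← h2]
    gcongr
  calc (m : ℝ≥0∞) = m * 1 := (mul_one _).symm
    _ ≤ m * (ENNReal.ofReal (K / τbar ^ d) * (ENNReal.ofReal ((τbar / 24) ^ d) * κ)) := by gcongr
    _ = ENNReal.ofReal (K / τbar ^ d) * (m * (ENNReal.ofReal ((τbar / 24) ^ d) * κ)) := by ring
    _ ≤ _ := by gcongr

/-- Tangent vectors at `x` are almost tangent at a nearby point `y`; the dual form of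
`norm_starProjection_normal_le`. -/
theorem norm_sub_starProjection_tangent_le {n : ℕ} {M : Set (E n)} {τ : ℝ} (hM : IsCompact M)
    (hτ : 0 < τ) (hall : ∀ p ∈ M, ∃ T : Submodule ℝ (E n), HasTangent M τ p T)
    {x y : E n} {T S : Submodule ℝ (E n)} (hx : HasTangent M τ x T) (hy : HasTangent M τ y S)
    {ℓ : ℝ} (hℓ : 0 < ℓ) (hxy : ‖x - y‖ ≤ ℓ) {v : E n} (hv : v ∈ T) :
    ‖v - S.starProjection v‖ ≤ 4 * ℓ / τ * ‖v‖ := by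
  set w := v - S.starProjection v with hw
  have hwS : w ∈ Sᗮ := S.sub_starProjection_mem_orthogonal v
  have h1 := norm_starProjection_normal_le hM hτ hall hy hx hℓ hxy hwS
  have h2 : ‖w‖ ^ 2 = ⟪T.starProjection w, v⟫_ℝ := by
    rw [T.inner_starProjection_left_eq_right, Submodule.starProjection_eq_self_iff.mpr hv,
      ← real_inner_self_eq_norm_sq]
    conv_lhs => rw [hw, inner_sub_right, ← hw]
    rw [Submodule.inner_left_of_mem_orthogonal (S.starProjection_apply_mem v) hwS, sub_zero]
  have h3 := real_inner_le_norm (T.starProjection w) v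
  have h4 : ‖w‖ ^ 2 ≤ 4 * ℓ / τ * ‖w‖ * ‖v‖ := by
    rw [h2]; exact h3.trans (by gcongr)
  rcases (norm_nonneg w).eq_or_lt with h0 | h0
  · rw [← h0]; positivity
  · refine le_of_mul_le_mul_left ?_ h0
    linarith

/-- The packet conditions, from the two properties of tangent spaces. The moved centre of the
`j`-th cylinder is the projection of `x_j` to the affine tangent space at `x_i`, so that a net
point close to the point of `M` above `p` projects to a moved centre at least as close to `p`. -/
theorem isCylinderPacket_of_hasTangent {n d m : ℕ} {M : Set (E n)} {τ τbar : ℝ}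
    (hM : IsCompact M) (hτ : 0 < τ) (hτbar : 0 < τbar)
    (hle : τbar ≤ 1 / (400 * rotConst d) * τ)
    (hall : ∀ p ∈ M, ∃ T : Submodule ℝ (E n), HasTangent M τ p T)
    {C : Fin m → Cylinder n d} (hC : ∀ i, HasTangent M τ (C i).center (C i).dir)
    (hnet : IsNet (τbar / 2) (range fun i => (C i).center) M)
    (hsep : ∀ i j : Fin m, i ≠ j → τbar / 2.9 ≤ ‖(C i).center - (C j).center‖) :
    IsCylinderPacket (packConst d + 7 * rotConst d) (vol d M) τ τbar C := by
  have hD := one_le_rotConst d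
  have hpack : 0 ≤ packConst d := by rw [packConst]; positivity
  have hsmall : 400 * rotConst d * τbar ≤ τ := by
    rw [div_mul_eq_mul_div, one_mul, le_div_iff₀ (by positivity)] at hle
    linarith
  have hsmall' : 400 * τbar ≤ τ := by nlinarith
  refine ⟨card_le_mul_vol hM hτ hτbar (by linarith) hall hC (fun i => (C i).finrank_dir) hsep
    (by linarith), fun i => ?_⟩
  have hdist : ∀ j ∈ neighbors C τbar i, ‖(C j).center - (C i).center‖ ≤ 3 * τbar := by
    rintro j ⟨-, y, hyj, hyi⟩
    have h1 := (C j).norm_le_of_mem_carrier hyj hτbar.le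
    have h2 := (C i).norm_le_of_mem_carrier hyi hτbar.le
    have h3 := norm_sub_le (y - (C i).center) (y - (C j).center)
    rw [sub_sub_sub_cancel_left] at h3
    linarith
  have hrot : ∀ j, ∃ R : E n ≃ₗᵢ[ℝ] E n, j ∈ neighbors C τbar i →
      LinearMap.det (R.toLinearEquiv : E n →ₗ[ℝ] E n) = 1 ∧
      (C j).dir.map (R.toLinearEquiv : E n →ₗ[ℝ] E n) = (C i).dir ∧
      ∀ v, ‖R v - v‖ ≤ rotConst d * (4 * (3 * τbar) / τ) * ‖v‖ := by
    intro j
    by_cases hj : j ∈ neighbors C τbar i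
    · obtain ⟨R, hR⟩ := exists_rotation_map_eq (C j).finrank_dir (C i).finrank_dir
        (δ := 4 * (3 * τbar) / τ) (by positivity)
        (fun v hv => norm_sub_starProjection_tangent_le hM hτ hall (hC j) (hC i) (by positivity)
          (hdist j hj) hv) (by
          rw [mul_div_assoc', div_le_one hτ]; nlinarith)
      exact ⟨R, fun _ => hR⟩
    · exact ⟨LinearIsometryEquiv.refl ℝ _, fun h => absurd h hj⟩
  choose R hR using hrot
  -- `w j` is the tangential part of `x_j - x_i` and `t j` removes its normal part
  set w : Fin m → E n := fun j => (C i).dir.starProjection ((C j).center - (C i).center) with hw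
  have hwdir : ∀ j, w j ∈ (C i).dir := fun j => Submodule.starProjection_apply_mem _ _
  set t : Fin m → E n := fun j => w j - ((C j).center - (C i).center) with ht
  have htw : ∀ j, (C j).center + t j = (C i).center + w j := fun j => by
    simp only [ht]; abel
  have hcen : ∀ j, rotAbout (C j).center (R j) (C j).center + t j = (C i).center + w j :=
    fun j => by rw [rotAbout, sub_self, map_zero, add_zero, htw]
  have htn : ∀ j ∈ neighbors C τbar i, ‖t j‖ ≤ 9 / 2 * (τbar ^ 2 / τ) := by
    intro j hj
    have h1 := (hC i).norm_normal_le (hC j).mem hτ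
    have h2 : t j = -(((C j).center - (C i).center) - w j) := by simp only [ht]; abel
    rw [h2, norm_neg]
    refine h1.trans ?_
    have h3 := hdist j hj
    calc ‖(C j).center - (C i).center‖ ^ 2 / (2 * τ) ≤ (3 * τbar) ^ 2 / (2 * τ) := by gcongr
      _ = _ := by field_simp; norm_num
  have hττ : τbar ^ 2 / τ ≤ τbar / 400 := by
    rw [div_le_div_iff₀ hτ (by norm_num)]; nlinarith
  have hττ0 : 0 < τbar ^ 2 / τ := by positivity
  refine ⟨R, t, fun j hj => (hR j hj).1, fun j hj => ?_, fun p hp => ?_, fun j hj v hv => ?_,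
    fun j hj => ?_⟩
  · refine ⟨w j, hwdir j, ?_, image_rotAbout_add (hR j hj).2.1 (htw j)⟩
    have h1 := hsep j i hj.1
    have h2 := norm_sub_le (w j) (t j)
    rw [show w j - t j = (C j).center - (C i).center by simp only [ht]; abel] at h2
    have h3 := htn j hj
    -- `1 / 2.9 - 9 / 800` exceeds `1 / 3`
    have h4 : τbar / 3 + 9 / 800 * τbar ≤ τbar / 2.9 := by
      rw [le_div_iff₀ (by norm_num)]; nlinarith
    linarith
  · obtain ⟨hpd, hpn⟩ := hp
    -- a point `q` of `M` above `p`, and a net point close to it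
    obtain ⟨q, hqM, hq1, hq2⟩ := (hC i).exists_starProjection_eq hM hτ hall hpd (by linarith)
    obtain ⟨_, ⟨j, rfl⟩, hj⟩ := hnet.2 q hqM
    simp only at hj
    have hclose : ‖p - ((C i).center + w j)‖ < τbar / 2 := by
      have h1 : p - ((C i).center + w j) =
          (C i).dir.starProjection (q - (C j).center) := by
        rw [← sub_sub, ← hq1, hw, ← map_sub, sub_sub_sub_cancel_right]
      rw [h1]
      exact (Submodule.norm_starProjection_apply_le _ _).trans_lt hj
    refine ⟨(C i).center + w j, ?_, hclose, fun hpi => ?_⟩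
    · by_cases hji : j = i
      · left
        simp [hw, hji]
      · right
        refine ⟨j, ⟨hji, ?_⟩, hcen j⟩
        -- both cylinders contain the midpoint of the centres
        have hqn : ‖q - (C i).center‖ ≤ 5 / 4 * τbar := by
          have h1 := (hC i).norm_normal_le hqM hτ
          rw [hq1] at h1
          have h2 := norm_add_le ((q - (C i).center) - (p - (C i).center)) (p - (C i).center)
          rw [sub_add_cancel] at h2
          have h3 : ‖q - (C i).center‖ ^ 2 / (2 * τ) ≤ (3 * τbar) ^ 2 / (2 * τ) := by
            gcongr; linarith
          have h4 : (3 * τbar) ^ 2 / (2 * τ) = 9 / 2 * (τbar ^ 2 / τ) := by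
            field_simp; norm_num
          linarith
        have hcc : ‖(C j).center - (C i).center‖ ≤ 2 * τbar := by
          have h1 := norm_sub_le (q - (C i).center) (q - (C j).center)
          rw [sub_sub_sub_cancel_left] at h1
          linarith
        refine ⟨midpoint ℝ (C j).center (C i).center, (C j).mem_carrier_of_norm_le ?_,
          (C i).mem_carrier_of_norm_le ?_⟩
        · rw [← dist_eq_norm, dist_midpoint_left, dist_eq_norm, Real.norm_of_nonneg (by norm_num)]
          linarith
        · rw [← dist_eq_norm, dist_midpoint_right, dist_eq_norm, Real.norm_of_nonneg (by norm_num)]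
          linarith
    · refine (C i).mem_carrier_of_norm_le ?_
      have h1 := norm_sub_le (p - (C i).center) (p - ((C i).center + w j))
      rw [sub_sub_sub_cancel_left] at h1
      linarith
  · have h1 : v - rotAbout (C j).center (R j) v =
        -((R j) (v - (C j).center) - (v - (C j).center)) := by rw [rotAbout]; abel
    rw [h1, norm_neg]
    refine ((hR j hj).2.2 _).trans_lt ?_
    have h2 : 0 < ‖v - (C j).center‖ := norm_pos_iff.mpr (sub_ne_zero.mpr hv)
    gcongr ?_ * _
    have h3 : rotConst d * (4 * (3 * τbar) / τ) = 6 * rotConst d * (2 * (τbar / τ)) := by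
      field_simp; norm_num
    rw [h3]
    have h4 : 0 < τbar / τ := by positivity
    nlinarith
  · refine (htn j hj).trans_lt ?_
    nlinarith

end CylPacket

theorem mainTheorem5 (d : ℕ) :
    ∃ c : ℝ, 0 < c ∧ ∃ K : ℝ, 0 < K ∧
      ∀ (n : ℕ) (M : Set (CylPacket.E n)) (Vmax : NNReal) (τ : ℝ), 0 < τ →
        CylPacket.InClass d Vmax τ M →
        ∀ τbar : ℝ, 0 < τbar → τbar ≤ c * τ →
        ∀ (m : ℕ) (C : Fin m → CylPacket.Cylinder n d),
          CylPacket.IsNet (τbar / 2) (Set.range fun i => (C i).center) M →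
          (∀ i j : Fin m, i ≠ j → τbar / 2.9 ≤ ‖(C i).center - (C j).center‖) →
          (∀ i : Fin m, CylPacket.IsTangentSpaceAt M d (C i).center (C i).dir) →
          CylPacket.IsCylinderPacket K (CylPacket.vol d M) τ τbar C := by
  have hD := CylPacket.one_le_rotConst d
  have hpack : 0 ≤ CylPacket.packConst d := by rw [CylPacket.packConst]; positivity
  refine ⟨1 / (400 * CylPacket.rotConst d), by positivity,
    CylPacket.packConst d + 7 * CylPacket.rotConst d, by positivity, ?_⟩
  intro n M Vmax τ hτ hM τbar hτbar hle m C hnet hsep htan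
  obtain ⟨hMc, r₁, r₂, -, -, hpatch⟩ := hM.imbedded
  refine CylPacket.isCylinderPacket_of_hasTangent hMc hτ hτbar hle (fun p hp => ?_) (fun i => ?_)
    hnet hsep
  · obtain ⟨T, -, hT⟩ := hpatch p hp
    exact ⟨T, hT.hasTangent hMc hτ hM.le_reach hp⟩
  · obtain ⟨hz, -, s₁, s₂, hT⟩ := htan i
    exact hT.hasTangent hMc hτ hM.le_reach hz
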